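/- Let $d\in\mathbb N$, $a>0$, $T>0$, $q\in(1,\infty)$, $q'=q/(q-1)$, $C_0>0$. Let $\mathbb T^d_a=\mathbb R^d/(a\mathbb Z^d)$, and equip all spaces $\mathcal P(\cdot)$ of Borel probability measures with the weak* topology (duality with bounded continuous functions). For $\mu\in\mathcal P(\mathbb T^d_a\times\mathbb R^d)$ set $$\Lambda_{q'}(\mu)=\Bigl(\int|\alpha|^{q'}\,d\mu(x,\alpha)\Bigr)^{1/q'}\in[0,\infty],\qquad \Lambda_\infty(\mu)=\sup\{|\alpha|:(x,\alpha)\in\operatorname{supp}\mu\}\in[0,\infty],$$ and for $R>0$ let $\mathcal P_{\infty,R}=\{\mu\in\mathcal P(\mathbb T^d_a\times\mathbb R^d):\Lambda_\infty(\mu)\le R\}$. Let $L:[0,T]\times\mathbb T^d_a\times\mathbb R^d\times\mathcal P(\mathbb T^d_a\times\mathbb R^d)\to\mathbb R$ satisfy: (A1) $L$ is differentiable with respect to $(x,\alpha)$, and $L$, $L_x$, $L_\alpha$ are continuous on $[0,T]\times\mathbb T^d_a\times\mathbb R^d\times\mathcal P_{\infty,R}$ for every $R>0$. (A2) For all $(t,x,p,\mu)\in[0,T]\times\mathbb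 T^d_a\times\mathbb R^d\times\mathcal P(\mathbb T^d_a\times\mathbb R^d)$, the supremum $H(t,x,p,\mu)=\sup_{\alpha\in\mathbb R^d}\bigl(-p\cdot\alpha-L(t,x,\alpha,\mu)\bigr)$ is attained at a unique $\alpha\in\mathbb R^d$. (A3) For all $t\in[0,T]$ and $\mu^1,\mu^2\in\mathcal P(\mathbb T^d_a\times\mathbb R^d)$ such that $L(t,\cdot,\cdot,\mu^1)-L(t,\cdot,\cdot,\mu^2)$ is integrable with respect to $\mu^1$ and $\mu^2$, $$\int_{\mathbb T^d_a\times\mathbb R^d}\bigl(L(t,x,\alpha,\mu^1)-L(t,x,\alpha,\mu^2)\bigr)\,d(\mu^1-\mu^2)(x,\alpha)\ge 0.$$ (A4) $L(t,x,\alpha,\mu)\ge C_0^{-1}|\alpha|^{q'}-C_0\bigl(1+\Lambda_{q'}(\mu)^{q'}\bigr)$ for all $(t,x,\alpha,\mu)$. (A5) $|L(t,x,\alpha,\mu)|\le C_0\bigl(1+|\alpha|^{q'}+\Lambda_{q'}(\mu)^{q'}\bigr)$ and $|L_x(t,x,\alpha,\mu)|\le C_0\bigl(1+|\alpha|^{q'}+\Lambda_{q'}(\mu)^{q'}\bigr)$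 for all $(t,x,\alpha,\mu)$. (When $\Lambda_{q'}(\mu)=\infty$ the inequalities in (A4) and (A5) hold trivially.) Let $p:[0,T]\times\mathbb T^d_a\to\mathbb R^d$ be continuous, and let $m:[0,T]\to\mathcal P(\mathbb T^d_a)$ be continuous, with second moments of $m(t)$ bounded uniformly in $t\in[0,T]$. Then $H$ is differentiable with respect to $p$; for every $t\in[0,T]$ there exists a unique $\mu(t)\in\mathcal P(\mathbb T^d_a\times\mathbb R^d)$ such that $$\mu(t)=\bigl(I_d,\,-H_p(t,\cdot,p(t,\cdot),\mu(t))\bigr)\#m(t),$$ where $I_d$ is the identity map of $\mathbb T^d_a$ and $\#$ denotes the image measure; and the map $t\mapsto\mu(t)$ is continuous from $[0,T]$ to $\mathcal P(\mathbb T^d_a\times\mathbb R^d)$ with the weak* topology. -/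

import Mathlib

open Set MeasureTheory Topology
open scoped ENNReal RealInnerProductSpace

noncomputable section

namespace MFGC

/-- The Euclidean space `ℝ^d`. -/
abbrev Euc (d : ℕ) : Type := EuclideanSpace ℝ (Fin d)

/-- The flat torus `ℝ^d / (a ℤ^d)`, coordinate by coordinate. -/
abbrev Torus (d : ℕ) (a : ℝ) : Type := Fin d → AddCircle a

/-- The canonical projection of `ℝ^d` onto the torus. -/
def Torus.proj (d : ℕ) (a : ℝ) (y : Euc d) : Torus d a := fun i => (y i : AddCircle a)

/-- Probability measures on (states) × (controls), with the topology of weak convergence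
(duality with bounded continuous functions), which is Mathlib's topology on
`ProbabilityMeasure`. -/
abbrev JointLaw (d : ℕ) (a : ℝ) : Type := ProbabilityMeasure (Torus d a × Euc d)

/-- Lagrangians `L(t, x, α, μ)` on the torus, with `t ∈ [0,T]`. -/
abbrev Lagrangian (d : ℕ) (a T : ℝ) : Type :=
  Icc (0 : ℝ) T → Torus d a → Euc d → JointLaw d a → ℝ

variable {d : ℕ} {a T : ℝ}

/-- `Λ_r(μ) = (∫ |α|^r dμ(x, α))^(1/r)`, with values in `[0, ∞]`. -/
def Lam (r : ℝ) (μ : JointLaw d a) : ℝ≥0∞ :=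
  (∫⁻ z, ‖z.2‖ₑ ^ r ∂(μ : Measure (Torus d a × Euc d))) ^ (1 / r)

/-- `Λ_∞(μ) = sup {|α| : (x, α) ∈ supp μ}`, with values in `[0, ∞]`. -/
def LamInf (μ : JointLaw d a) : ℝ≥0∞ :=
  ⨆ z ∈ (μ : Measure (Torus d a × Euc d)).support, ‖z.2‖ₑ

/-- The set of joint laws with `Λ_∞(μ) ≤ R`; since `R` is finite, the second marginal of such
a law is compactly supported. -/
def LawsBoundedBy (d : ℕ) (a R : ℝ) : Set (JointLaw d a) :=
  {μ | LamInf μ ≤ ENNReal.ofReal R}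

/-- The partial gradient `L_x(t, x, α, μ)`, computed in the flat coordinates of the torus
around `x`. -/
def gradX (L : Lagrangian d a T) (t : Icc (0 : ℝ) T) (x : Torus d a) (α : Euc d)
    (μ : JointLaw d a) : Euc d :=
  gradient (fun h : Euc d => L t (x + Torus.proj d a h) α μ) 0

/-- The partial gradient `L_α(t, x, α, μ)`. -/
def gradA (L : Lagrangian d a T) (t : Icc (0 : ℝ) T) (x : Torus d a) (α : Euc d)
    (μ : JointLaw d a) : Euc d :=
  gradient (fun β : Euc d => L t x β μ) α

/-- The Hamiltonian `H(t, x, p, μ) = sup_α (- p · α - L(t, x, α, μ))`. -/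
def Ham (L : Lagrangian d a T) (t : Icc (0 : ℝ) T) (x : Torus d a) (p : Euc d)
    (μ : JointLaw d a) : ℝ :=
  ⨆ α : Euc d, (-⟪p, α⟫ - L t x α μ)

/-- The gradient `H_p(t, x, p, μ)` of the Hamiltonian with respect to `p`. -/
def gradHam (L : Lagrangian d a T) (t : Icc (0 : ℝ) T) (x : Torus d a) (p : Euc d)
    (μ : JointLaw d a) : Euc d :=
  gradient (fun p' : Euc d => Ham L t x p' μ) p

/-- (A1) `L` is differentiable in `(x, α)`; `L`, `L_x`, `L_α` are continuous on
`[0,T] × 𝕋 × ℝ^d × {Λ_∞ ≤ R}` for every `R > 0`. -/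
structure RegularLagrangian (L : Lagrangian d a T) : Prop where
  differentiable : ∀ (t : Icc (0 : ℝ) T) (x : Torus d a) (α : Euc d) (μ : JointLaw d a),
    DifferentiableAt ℝ
      (fun h : Euc d × Euc d => L t (x + Torus.proj d a h.1) (α + h.2) μ) 0
  continuous_L : ∀ R : ℝ, 0 < R →
    ContinuousOn
      (fun z : Icc (0 : ℝ) T × Torus d a × Euc d × JointLaw d a =>
        L z.1 z.2.1 z.2.2.1 z.2.2.2)
      {z | z.2.2.2 ∈ LawsBoundedBy d a R}
  continuous_gradX : ∀ R : ℝ, 0 < R →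
    ContinuousOn
      (fun z : Icc (0 : ℝ) T × Torus d a × Euc d × JointLaw d a =>
        gradX L z.1 z.2.1 z.2.2.1 z.2.2.2)
      {z | z.2.2.2 ∈ LawsBoundedBy d a R}
  continuous_gradA : ∀ R : ℝ, 0 < R →
    ContinuousOn
      (fun z : Icc (0 : ℝ) T × Torus d a × Euc d × JointLaw d a =>
        gradA L z.1 z.2.1 z.2.2.1 z.2.2.2)
      {z | z.2.2.2 ∈ LawsBoundedBy d a R}

/-- (A2) The supremum defining `H(t, x, p, μ)` is attained at exactly one control. -/
def UniqueMaximizer (L : Lagrangian d a T) : Prop :=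
  ∀ (t : Icc (0 : ℝ) T) (x : Torus d a) (p : Euc d) (μ : JointLaw d a),
    ∃! α : Euc d, ∀ β : Euc d, -⟪p, β⟫ - L t x β μ ≤ -⟪p, α⟫ - L t x α μ

/-- (A3) Monotonicity, `∫ (L(t, ·, μ₁) - L(t, ·, μ₂)) d(μ₁ - μ₂) ≥ 0`, required for those pairs
for which the integral is defined. -/
def MonotoneLagrangian (L : Lagrangian d a T) : Prop :=
  ∀ (t : Icc (0 : ℝ) T) (μ₁ μ₂ : JointLaw d a),
    Integrable (fun z : Torus d a × Euc d => L t z.1 z.2 μ₁ - L t z.1 z.2 μ₂)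
      (μ₁ : Measure (Torus d a × Euc d)) →
    Integrable (fun z : Torus d a × Euc d => L t z.1 z.2 μ₁ - L t z.1 z.2 μ₂)
      (μ₂ : Measure (Torus d a × Euc d)) →
    0 ≤ (∫ z, (L t z.1 z.2 μ₁ - L t z.1 z.2 μ₂) ∂(μ₁ : Measure (Torus d a × Euc d)))
      - ∫ z, (L t z.1 z.2 μ₁ - L t z.1 z.2 μ₂) ∂(μ₂ : Measure (Torus d a × Euc d))

/-- (A4) `L ≥ C₀⁻¹ |α|^r - C₀ (1 + Λ_r(μ)^r)`. The inequality says nothing when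
`Λ_r(μ) = ∞`. -/
def CoerciveLagrangian (L : Lagrangian d a T) (r C₀ : ℝ) : Prop :=
  ∀ (t : Icc (0 : ℝ) T) (x : Torus d a) (α : Euc d) (μ : JointLaw d a), Lam r μ ≠ ∞ →
    C₀⁻¹ * ‖α‖ ^ r - C₀ * (1 + (Lam r μ).toReal ^ r) ≤ L t x α μ

/-- (A5) `|L|` and `|L_x|` are at most `C₀ (1 + |α|^r + Λ_r(μ)^r)`. The inequalities say nothing
when `Λ_r(μ) = ∞`. -/
def BoundedLagrangian (L : Lagrangian d a T) (r C₀ : ℝ) : Prop :=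
  ∀ (t : Icc (0 : ℝ) T) (x : Torus d a) (α : Euc d) (μ : JointLaw d a), Lam r μ ≠ ∞ →
    |L t x α μ| ≤ C₀ * (1 + ‖α‖ ^ r + (Lam r μ).toReal ^ r) ∧
    ‖gradX L t x α μ‖ ≤ C₀ * (1 + ‖α‖ ^ r + (Lam r μ).toReal ^ r)

/-- The fixed point relation `μ = (I_d, -H_p(t, ·, p(·), μ)) # m` at time `t`. The map is part
of the relation: it has to be measurable for the image measure to make sense. -/
def IsFixedPointLaw (L : Lagrangian d a T) (t : Icc (0 : ℝ) T) (p : Torus d a → Euc d)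
    (m : ProbabilityMeasure (Torus d a)) (μ : JointLaw d a) : Prop :=
  AEMeasurable (fun x : Torus d a => (x, -gradHam L t x (p x) μ))
      (m : Measure (Torus d a)) ∧
    (μ : Measure (Torus d a × Euc d)) =
      (m : Measure (Torus d a)).map (fun x => (x, -gradHam L t x (p x) μ))

end MFGC

end

/-! A fixed point is an equilibrium of a static game. With `cost` the function L(t,x,α,μ) + p(x)·α,
it is a law μ with state marginal m(t) that minimizes ν ↦ ∫ cost_μ dν among laws of bounded controls
with that marginal. This is a variational inequality for μ ↦ cost_μ, an operator that (A3) makes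
monotone (`integral_cost_monotone`).

Uniqueness: adding the inequalities of two solutions and using monotonicity gives equality, and
since minimizing controls are unique, both laws sit on one graph.

Existence follows Minty. On the compact convex set of laws with |α| ≤ R, `exists_minty` solves the
weak inequality ∫ cost_ν dμ ≤ ∫ cost_ν dν, by finite intersections and a matrix alternative;
`integral_cost_le_of_minty` turns it into the strong one by moving along segments. Testing against
zero control, `exists_optControl_bound` gives R, depending only on C₀, the exponent and sup |p|,
beyond which the constraint is inactive.

Continuity: every fixed point satisfies the weak inequality, so R serves all times; limits of fixed
points are fixed points, and uniqueness identifies them.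

For the pointwise problem, continuity and unique maximizers for every slope already force L to be
convex in α and H to be differentiable in p. Convexity then makes the optimal control continuous in
x, even for laws with infinite moments, where (A4) is void. -/

namespace MFGC

open Filter

/-! ### Finite-dimensional alternative and Minty's inequality -/

section Minimax

/-- A square matrix whose quadratic form is nonnegative on the nonnegative orthant admits a
probability vector with nonnegative image. -/
theorem exists_stdSimplex_mulVec_nonneg {ι : Type*} [Fintype ι] [Nonempty ι] (M : Matrix ι ι ℝ)
    (hM : ∀ w : ι → ℝ, (∀ i, 0 ≤ w i) → 0 ≤ ∑ i, w i * ∑ j, M i j * w j) :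
    ∃ w ∈ stdSimplex ℝ ι, ∀ i, 0 ≤ ∑ j, M i j * w j := by
  classical
  by_contra hne
  push Not at hne
  have hlin : IsLinearMap ℝ (fun w : ι → ℝ => fun i => ∑ j, M i j * w j) := by
    constructor
    · intro x y
      ext i
      simp [mul_add, Finset.sum_add_distrib]
    · intro c x
      ext i
      simp only [Pi.smul_apply, smul_eq_mul, Finset.mul_sum]
      exact Finset.sum_congr rfl fun j _ => by ring
  have hcont : Continuous (fun w : ι → ℝ => fun i => ∑ j, M i j * w j) := by fun_prop
  -- If the image of the simplex misses the orthant, a separating functional has nonnegative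
  -- coefficients `y`; testing the quadratic form on normalized `y` contradicts `hM`.
  obtain ⟨f, u, v, hfu, huv, hfv⟩ := geometric_hahn_banach_compact_closed
    ((convex_stdSimplex ℝ ι).is_linear_image hlin)
    ((isCompact_stdSimplex ℝ ι).image hcont)
    (convex_Ici (0 : ι → ℝ)) isClosed_Ici (by
      rw [Set.disjoint_left]
      rintro _ ⟨w, hw, rfl⟩ h0
      obtain ⟨i, hi⟩ := hne w hw
      exact absurd (h0 i) (not_le.mpr hi))
  have hv0 : v < 0 := by simpa using hfv 0 (by simp)
  have hf : ∀ x : ι → ℝ, f x = ∑ i, x i * f (Pi.single i 1) := by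
    intro x
    conv_lhs => rw [pi_eq_sum_univ' x]
    simp [map_sum]
  have hy : ∀ i, 0 ≤ f (Pi.single i 1) := by
    intro i
    by_contra hi
    push Not at hi
    -- The multiple is chosen so that `f` takes exactly the excluded value `v`.
    have h := hfv ((v / f (Pi.single i 1)) • Pi.single i 1) (by
      rw [Set.mem_Ici]
      exact smul_nonneg (div_nonneg_of_nonpos hv0.le hi.le)
        (by intro j; by_cases hj : j = i <;> simp [hj]))
    rw [map_smul, smul_eq_mul, div_mul_cancel₀ _ hi.ne] at h
    exact lt_irrefl _ h
  set y : ι → ℝ := fun i => f (Pi.single i 1) with hydef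
  have hneg : ∀ w ∈ stdSimplex ℝ ι, ∑ i, (∑ j, M i j * w j) * y i < 0 := by
    intro w hw
    have := hfu _ ⟨w, hw, rfl⟩
    rw [hf] at this
    linarith
  set s : ℝ := ∑ i, y i with hs
  have hs0 : 0 < s := by
    rcases (Finset.sum_nonneg fun i _ => hy i : 0 ≤ s).lt_or_eq with h | h
    · exact h
    · exfalso
      have hz : ∀ i, y i = 0 := fun i =>
        (Finset.sum_eq_zero_iff_of_nonneg fun i _ => hy i).1 h.symm i (Finset.mem_univ i)
      have := hneg (Pi.single (Classical.arbitrary ι) 1) (single_mem_stdSimplex ℝ _)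
      simp [hz] at this
  have h1 := hneg (fun i => s⁻¹ * y i)
    ⟨fun i => mul_nonneg (inv_nonneg.2 hs0.le) (hy i), by
      rw [← Finset.mul_sum]
      exact inv_mul_cancel₀ hs0.ne'⟩
  have h2 := hM y hy
  have h3 : ∑ i, (∑ j, M i j * (s⁻¹ * y j)) * y i = s⁻¹ * ∑ i, y i * ∑ j, M i j * y j := by
    simp only [Finset.mul_sum, Finset.sum_mul]
    exact Finset.sum_congr rfl fun i _ => Finset.sum_congr rfl fun j _ => by ring
  rw [h3] at h1
  exact absurd (mul_nonneg (inv_nonneg.2 hs0.le) h2) (not_le.mpr h1)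

/-- Existence of a solution of the Minty variational inequality on a compact convex set, for a
monotone pairing. -/
theorem exists_minty {Y : Type*} [TopologicalSpace Y] {S : Set Y} (hS : IsCompact S)
    (hne : S.Nonempty) (B : Y → Y → ℝ) (hB : ∀ ν ∈ S, ContinuousOn (B ν) S)
    (hmix : ∀ (s : Finset S) (w : s → ℝ), w ∈ stdSimplex ℝ s →
      ∃ μ ∈ S, ∀ ν ∈ S, B ν μ = ∑ i, w i * B ν (i : S))
    (hmono : ∀ μ ∈ S, ∀ ν ∈ S, 0 ≤ B μ μ - B μ ν - B ν μ + B ν ν) :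
    ∃ μ ∈ S, ∀ ν ∈ S, B ν μ ≤ B ν ν := by
  have hSc : CompactSpace S := isCompact_iff_compactSpace.1 hS
  have key := (isCompact_univ (X := S)).inter_iInter_nonempty
    (fun ν : S => {μ : S | B ν μ ≤ B ν ν})
    (fun ν => isClosed_le (continuousOn_iff_continuous_domRestrict.1 (hB ν ν.2)) continuous_const) (by
      intro s
      rcases s.eq_empty_or_nonempty with rfl | hs
      · obtain ⟨x, hx⟩ := hne
        exact ⟨⟨x, hx⟩, by simp⟩
      have : Nonempty s := hs.to_subtype
      obtain ⟨w, hw, hwn⟩ := exists_stdSimplex_mulVec_nonneg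
        (fun i j : s => B (i : S) (i : S) - B (i : S) (j : S)) (by
          intro w hw
          -- Monotonicity controls only the symmetric part, so the double sum is averaged with its
          -- transpose.
          have e1 : ∑ i : s, w i * ∑ j : s, (B (i : S) (i : S) - B (i : S) (j : S)) * w j
              = ∑ i : s, ∑ j : s, (B (i : S) (i : S) - B (i : S) (j : S)) * w i * w j := by
            simp only [Finset.mul_sum]
            exact Finset.sum_congr rfl fun i _ => Finset.sum_congr rfl fun j _ => by ring
          have e2 : ∑ i : s, ∑ j : s, (B (i : S) (i : S) - B (i : S) (j : S)) * w i * w j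
              = ∑ i : s, ∑ j : s, (B (j : S) (j : S) - B (j : S) (i : S)) * w i * w j := by
            rw [Finset.sum_comm]
            exact Finset.sum_congr rfl fun i _ => Finset.sum_congr rfl fun j _ => by ring
          have e3 : 0 ≤ ∑ i : s, ∑ j : s, ((B (i : S) (i : S) - B (i : S) (j : S)) * w i * w j
              + (B (j : S) (j : S) - B (j : S) (i : S)) * w i * w j) := by
            refine Finset.sum_nonneg fun i _ => Finset.sum_nonneg fun j _ => ?_
            have := mul_nonneg (mul_nonneg
              (hmono (i : S) (i : S).2 (j : S) (j : S).2) (hw i)) (hw j)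
            linarith
          simp only [Finset.sum_add_distrib] at e3
          linarith)
      obtain ⟨μ, hμ, hμB⟩ := hmix s w hw
      refine ⟨⟨μ, hμ⟩, mem_univ _, ?_⟩
      simp only [mem_iInter, mem_ofPred_eq]
      intro ν hν
      have h := hwn ⟨ν, hν⟩
      simp only [sub_mul, Finset.sum_sub_distrib, ← Finset.mul_sum, hw.2] at h
      rw [hμB ν ν.2]
      have e : ∑ i : s, w i * B ν (i : S) = ∑ i : s, B ν (i : S) * w i :=
        Finset.sum_congr rfl fun i _ => mul_comm _ _
      linarith)
  obtain ⟨μ, -, hμ⟩ := key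
  simp only [mem_iInter, mem_ofPred_eq] at hμ
  exact ⟨μ, μ.2, fun ν hν => hμ ⟨ν, hν⟩⟩

end Minimax

/-! ### Legendre transform under uniqueness of maximizers -/

section Legendre

variable {E : Type*} [NormedAddCommGroup E] [InnerProductSpace ℝ E]

/-- For every slope `p`, the function `α ↦ -⟪p, α⟫ - f α` has exactly one maximizer. -/
def HasUniqueMaximizers (f : E → ℝ) : Prop :=
  ∀ p : E, ∃! α : E, ∀ β : E, -⟪p, β⟫ - f β ≤ -⟪p, α⟫ - f α

variable {f : E → ℝ}

theorem HasUniqueMaximizers.exists_maximizer (hf : HasUniqueMaximizers f) :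
    ∃ A : E → E, (∀ p β, -⟪p, β⟫ - f β ≤ -⟪p, A p⟫ - f (A p)) ∧
      ∀ p α, (∀ β, -⟪p, β⟫ - f β ≤ -⟪p, α⟫ - f α) → α = A p := by
  choose A hA using hf
  exact ⟨A, fun p => (hA p).1, fun p α h => (hA p).2 α h⟩

theorem legendre_eq {p α : E} (h : ∀ β, -⟪p, β⟫ - f β ≤ -⟪p, α⟫ - f α) :
    ⨆ β : E, (-⟪p, β⟫ - f β) = -⟪p, α⟫ - f α :=
  le_antisymm (ciSup_le h) (le_ciSup ⟨_, by rintro _ ⟨β, rfl⟩; exact h β⟩ α)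

variable [FiniteDimensional ℝ E]

/-- The negated maximizer `-A` is a subgradient of the transform. The transform is finite and
convex, hence continuous, which bounds `A` locally; closedness of the graph and uniqueness make `A`
continuous at `p`, and a subgradient selection continuous at a point is the gradient there. No
coercivity of `f` enters. -/
theorem HasUniqueMaximizers.hasGradientAt (hf : HasUniqueMaximizers f) (hc : Continuous f)
    {p α : E} (hα : ∀ β, -⟪p, β⟫ - f β ≤ -⟪p, α⟫ - f α) :
    HasGradientAt (fun p' : E => ⨆ β : E, (-⟪p', β⟫ - f β)) (-α) p := by
  obtain ⟨A, hA, hAu⟩ := hf.exists_maximizer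
  set h : E → ℝ := fun p' => ⨆ β : E, (-⟪p', β⟫ - f β) with hh
  have hval : ∀ p, h p = -⟪p, A p⟫ - f (A p) := fun p => legendre_eq (hA p)
  have hsub : ∀ p p', h p - ⟪p' - p, A p⟫ ≤ h p' := by
    intro p p'
    rw [hval p, hval p', inner_sub_left]
    linarith [hA p' (A p)]
  have hconv : ConvexOn ℝ univ h := by
    refine ⟨convex_univ, fun x _ y _ s t hs ht hst => ?_⟩
    set z := s • x + t • y
    have h1 := hsub z x
    have h2 := hsub z y
    have e : s * ⟪x - z, A z⟫ + t * ⟪y - z, A z⟫ = 0 := by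
      rw [← real_inner_smul_left, ← real_inner_smul_left, ← inner_add_left]
      have : s • (x - z) + t • (y - z) = 0 := by
        have hz : (s + t) • z = z := by rw [hst, one_smul]
        rw [smul_sub, smul_sub, sub_add_sub_comm, ← add_smul, hz, sub_self]
      rw [this, inner_zero_left]
    simp only [smul_eq_mul]
    have h1' := mul_le_mul_of_nonneg_left h1 hs
    have h2' := mul_le_mul_of_nonneg_left h2 ht
    have e2 : s * h z + t * h z = h z := by rw [← add_mul, hst, one_mul]
    nlinarith
  have hcont : Continuous h :=
    continuousOn_univ.1 (hconv.continuousOn isOpen_univ)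
  obtain ⟨C, hC⟩ := (isCompact_closedBall p 2).exists_bound_of_continuousOn hcont.continuousOn
  have hbd : ∀ p' ∈ Metric.ball p 1, A p' ∈ Metric.closedBall (0 : E) (2 * C) := by
    intro p' hp'
    rw [mem_closedBall_zero_iff]
    rw [mem_ball_iff_norm] at hp'
    by_cases h0 : A p' = 0
    · rw [h0, norm_zero]
      have := (norm_nonneg _).trans (hC p (by simp))
      positivity
    have hn : ‖A p'‖ ≠ 0 := norm_ne_zero_iff.2 h0
    -- A unit step against `A p'` raises `h` by at least `‖A p'‖`.
    have h1 := hsub p' (p' - ‖A p'‖⁻¹ • A p')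
    have e : ⟪p' - ‖A p'‖⁻¹ • A p' - p', A p'⟫ = -‖A p'‖ := by
      rw [sub_sub_cancel_left, inner_neg_left, real_inner_smul_left,
        real_inner_self_eq_norm_sq]
      field_simp
    rw [e] at h1
    have hb1 := hC p' (by rw [mem_closedBall_iff_norm]; linarith)
    have hb2 := hC (p' - ‖A p'‖⁻¹ • A p') (by
      rw [mem_closedBall_iff_norm]
      have : ‖‖A p'‖⁻¹ • A p'‖ = 1 := by
        rw [norm_smul, norm_inv, norm_norm, inv_mul_cancel₀ hn]
      calc ‖p' - ‖A p'‖⁻¹ • A p' - p‖ = ‖(p' - p) - ‖A p'‖⁻¹ • A p'‖ := by congr 1; abel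
        _ ≤ ‖p' - p‖ + ‖‖A p'‖⁻¹ • A p'‖ := norm_sub_le _ _
        _ ≤ 2 := by linarith)
    rw [Real.norm_eq_abs] at hb1 hb2
    linarith [abs_le.1 hb1, abs_le.1 hb2]
  have hAp : A p = α := (hAu p α hα).symm
  have hAc : Tendsto A (𝓝 p) (𝓝 α) := by
    rw [tendsto_iff_ultrafilter]
    intro g hg
    obtain ⟨b, -, hb⟩ := (isCompact_closedBall (0 : E) (2 * C)).ultrafilter_le_nhds (g.map A) (by
      rw [Ultrafilter.coe_map, le_principal_iff, mem_map]
      exact mem_of_superset (hg (Metric.ball_mem_nhds p one_pos)) hbd)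
    rw [Ultrafilter.coe_map] at hb
    have hgA : Tendsto A g (𝓝 b) := hb
    have hgi : Tendsto (fun x : E => x) g (𝓝 p) := hg
    have : b = A p := by
      refine hAu p b fun β => ?_
      have hl : Tendsto (fun p' : E => -⟪p', β⟫ - f β) g (𝓝 (-⟪p, β⟫ - f β)) :=
        (hgi.inner tendsto_const_nhds).neg.sub tendsto_const_nhds
      have hr : Tendsto (fun p' : E => -⟪p', A p'⟫ - f (A p')) g (𝓝 (-⟪p, b⟫ - f b)) :=
        (hgi.inner hgA).neg.sub ((hc.tendsto b).comp hgA)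
      exact le_of_tendsto_of_tendsto hl hr (Eventually.of_forall fun p' => hA p' β)
    rw [this, hAp] at hgA
    exact hgA
  rw [hasGradientAt_iff_isLittleO, Asymptotics.isLittleO_iff]
  intro c hc0
  have hev : ∀ᶠ p' in 𝓝 p, ‖A p' - α‖ < c := by
    have := hAc (Metric.ball_mem_nhds α hc0)
    filter_upwards [this] with p' hp'
    rwa [mem_preimage, mem_ball_iff_norm] at hp'
  -- The increment of `h` is squeezed between the subgradient inequalities at `p` and at `p'`.
  filter_upwards [hev] with p' hp'
  have h1 := hsub p p'
  have h2 := hsub p' p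
  rw [hAp] at h1
  have h3 : ⟪p - p', A p'⟫ = -⟪p' - p, A p' - α⟫ - ⟪p' - p, α⟫ := by
    rw [inner_sub_right, ← neg_sub p' p, inner_neg_left]
    ring
  have h4 : -⟪p' - p, A p' - α⟫ ≤ ‖p' - p‖ * ‖A p' - α‖ :=
    (neg_le_abs _).trans (abs_real_inner_le_norm _ _)
  have h5 : ‖p' - p‖ * ‖A p' - α‖ ≤ c * ‖p' - p‖ := by
    rw [mul_comm c]
    exact mul_le_mul_of_nonneg_left hp'.le (norm_nonneg _)
  have h6 : (0 : ℝ) ≤ c * ‖p' - p‖ := by positivity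
  rw [inner_neg_left, real_inner_comm, Real.norm_eq_abs, abs_le]
  constructor <;> linarith

/-- A continuous function with unique maximizers has a supporting affine function at every
point. -/
theorem HasUniqueMaximizers.exists_support (hf : HasUniqueMaximizers f) (hc : Continuous f)
    (α : E) : ∃ p : E, ∀ β, -⟪p, β⟫ - f β ≤ -⟪p, α⟫ - f α := by
  obtain ⟨A, hA, hAu⟩ := hf.exists_maximizer
  set h : E → ℝ := fun p' => ⨆ β : E, (-⟪p', β⟫ - f β) with hh
  have hgrad : ∀ p, HasGradientAt h (-A p) p := fun p => hf.hasGradientAt hc (hA p)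
  have hcont : Continuous h :=
    continuous_iff_continuousAt.2 fun p => (hgrad p).hasFDerivAt.continuousAt
  have hge : ∀ p β, -⟪p, β⟫ - f β ≤ h p := by
    intro p β
    rw [show h p = _ from legendre_eq (hA p)]
    exact hA p β
  obtain ⟨C, hC⟩ := (isCompact_closedBall α 1).exists_bound_of_continuousOn hc.continuousOn
  -- Coercivity of `h + ⟪·, α⟫`, from testing the supremum one unit away from `α`. At a minimizer
  -- `p` the gradient `α - A p` vanishes, so `p` is the slope sought.
  have hlow : ∀ p, ‖p‖ - C ≤ h p + ⟪p, α⟫ := by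
    intro p
    have h1 := hge p (α - ‖p‖⁻¹ • p)
    have h2 := hC (α - ‖p‖⁻¹ • p) (by
      rw [mem_closedBall_iff_norm, sub_sub_cancel_left, norm_neg, norm_smul, norm_inv, norm_norm]
      exact inv_mul_le_one)
    rw [Real.norm_eq_abs] at h2
    rw [inner_sub_right, real_inner_smul_right, real_inner_self_eq_norm_sq] at h1
    have h3 : ‖p‖⁻¹ * ‖p‖ ^ 2 = ‖p‖ := by
      by_cases h0 : ‖p‖ = 0
      · simp [h0]
      · field_simp
    rw [h3] at h1
    linarith [abs_le.1 h2]
  obtain ⟨p, hp⟩ := (hcont.add (continuous_id.inner continuous_const) :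
      Continuous fun p => h p + ⟪p, α⟫).exists_forall_le
    (tendsto_atTop_mono hlow
      (tendsto_atTop_add_const_right _ (-C) (tendsto_norm_cocompact_atTop (E := E))))
  have hd := (hgrad p).hasFDerivAt.add ((innerSL ℝ α).hasFDerivAt (x := p))
  have hmin : IsLocalMin (h + fun q => innerSL ℝ α q) p := by
    refine Eventually.of_forall fun q => ?_
    simpa [real_inner_comm] using hp q
  have h0 := hmin.hasFDerivAt_eq_zero hd
  have h1 : A p = α := by
    have h2 := congrArg (fun l => l (α - A p)) h0
    simp only [add_apply, InnerProductSpace.toDual_apply_apply,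
      innerSL_apply_apply, zero_apply] at h2
    rw [← inner_add_left, neg_add_eq_sub, inner_self_eq_zero] at h2
    exact (sub_eq_zero.1 h2).symm
  exact ⟨p, by rw [← h1]; exact hA p⟩

theorem HasUniqueMaximizers.convexOn (hf : HasUniqueMaximizers f) (hc : Continuous f) :
    ConvexOn ℝ univ f := by
  refine ⟨convex_univ, fun x _ y _ s t hs ht hst => ?_⟩
  obtain ⟨p, hp⟩ := hf.exists_support hc (s • x + t • y)
  have h1 := mul_le_mul_of_nonneg_left (hp x) hs
  have h2 := mul_le_mul_of_nonneg_left (hp y) ht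
  rw [inner_add_right, real_inner_smul_right, real_inner_smul_right] at h1 h2
  obtain rfl : t = 1 - s := by linarith
  simp only [smul_eq_mul]
  nlinarith

end Legendre

/-- The unique minimizer of a jointly continuous family of convex functions depends continuously
on the parameter. -/
theorem continuous_argmin_of_convexOn {X E : Type*} [TopologicalSpace X] [NormedAddCommGroup E]
    [NormedSpace ℝ E] [ProperSpace E] {F : X → E → ℝ}
    (hF : Continuous fun z : X × E => F z.1 z.2) (hconv : ∀ x, ConvexOn ℝ univ (F x)) {A : X → E}
    (hA : ∀ x β, F x (A x) ≤ F x β) (hAu : ∀ x β, F x β ≤ F x (A x) → β = A x) :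
    Continuous A := by
  rw [continuous_iff_continuousAt]
  intro x₀
  rw [ContinuousAt, Metric.tendsto_nhds]
  intro ε hε
  -- The strict gap on a sphere around `A x₀` persists for nearby `x`. Convexity then keeps the
  -- minimizer inside: a minimizer outside would give a point of the sphere, on the segment from `A
  -- x₀`, with value at most `F x (A x₀)`.
  have hev := (isCompact_sphere (A x₀) ε).eventually_forall_of_forall_eventually (x₀ := x₀)
    (P := fun x β => F x (A x₀) < F x β) (by
      intro β hβ
      have hlt : F x₀ (A x₀) < F x₀ β := by
        by_contra hle
        have := hAu x₀ β (not_lt.1 hle)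
        rw [this, mem_sphere_iff_norm, sub_self, norm_zero] at hβ
        exact hε.ne hβ
      have h1 : Continuous fun z : X × E => F z.1 (A x₀) :=
        hF.comp (continuous_fst.prodMk continuous_const)
      exact (h1.tendsto (x₀, β)).eventually_lt (hF.tendsto (x₀, β)) hlt)
  filter_upwards [hev] with x hx
  by_contra hfar
  rw [dist_eq_norm, not_lt] at hfar
  have hpos : 0 < ‖A x - A x₀‖ := hε.trans_le hfar
  set s := ε / ‖A x - A x₀‖ with hs
  have hs0 : 0 ≤ s := by positivity
  have hs1 : s ≤ 1 := (div_le_one hpos).2 hfar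
  have h1 := hx ((1 - s) • A x₀ + s • A x) (by
    rw [mem_sphere_iff_norm]
    have : (1 - s) • A x₀ + s • A x - A x₀ = s • (A x - A x₀) := by
      rw [sub_smul, one_smul, smul_sub]
      abel
    rw [this, norm_smul, Real.norm_of_nonneg hs0, hs, div_mul_cancel₀ _ hpos.ne'])
  have h2 := (hconv x).2 (mem_univ (A x₀)) (mem_univ (A x)) (sub_nonneg.2 hs1) hs0
    (sub_add_cancel 1 s)
  simp only [smul_eq_mul] at h2
  have h3 := mul_le_mul_of_nonneg_left (hA x (A x₀)) hs0
  linarith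

/-! ### Mixtures, laws carried by a compact set, graphs -/

section Measures

variable {X : Type*} [MeasurableSpace X]

theorem exists_mixture {ι : Type*} [Fintype ι] {w : ι → ℝ} (hw : w ∈ stdSimplex ℝ ι)
    (ν : ι → ProbabilityMeasure X) :
    ∃ μ : ProbabilityMeasure X,
      (μ : Measure X) = ∑ i, ENNReal.ofReal (w i) • (ν i : Measure X) := by
  refine ⟨⟨∑ i, ENNReal.ofReal (w i) • (ν i : Measure X), ⟨?_⟩⟩, rfl⟩
  simp only [Measure.finsetSum_apply, Measure.smul_apply, measure_univ, smul_eq_mul, mul_one]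
  rw [← ENNReal.ofReal_sum_of_nonneg fun i _ => hw.1 i, hw.2, ENNReal.ofReal_one]

theorem integral_mixture {ι : Type*} [Fintype ι] {w : ι → ℝ} (hw : ∀ i, 0 ≤ w i)
    {ν : ι → ProbabilityMeasure X} {μ : Measure X}
    (hμ : μ = ∑ i, ENNReal.ofReal (w i) • (ν i : Measure X)) {f : X → ℝ}
    (hf : ∀ i, Integrable f (ν i : Measure X)) :
    ∫ x, f x ∂μ = ∑ i, w i * ∫ x, f x ∂(ν i : Measure X) := by
  rw [hμ, integral_finsetSum_measure fun i _ => (hf i).smul_measure ENNReal.ofReal_ne_top]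
  refine Finset.sum_congr rfl fun i _ => ?_
  rw [integral_smul_measure, ENNReal.toReal_ofReal (hw i), smul_eq_mul]

theorem ae_mixture {ι : Type*} [Fintype ι] {w : ι → ℝ} {ν : ι → ProbabilityMeasure X}
    {μ : Measure X} (hμ : μ = ∑ i, ENNReal.ofReal (w i) • (ν i : Measure X)) {P : X → Prop}
    (hP : ∀ i, ∀ᵐ x ∂(ν i : Measure X), P x) : ∀ᵐ x ∂μ, P x := by
  have h : ∀ i, (ν i : Measure X) {x | ¬ P x} = 0 := fun i => ae_iff.1 (hP i)
  rw [ae_iff, hμ]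
  simp [h]

variable [TopologicalSpace X] [BorelSpace X]

theorem integrable_of_ae_mem_isCompact {K : Set X} (hK : IsCompact K) {f : X → ℝ}
    (hf : Continuous f) {μ : Measure X} [IsFiniteMeasure μ] (hμ : ∀ᵐ x ∂μ, x ∈ K) :
    Integrable f μ := by
  obtain ⟨C, hC⟩ := hK.exists_bound_of_continuousOn hf.continuousOn
  exact Integrable.of_bound hf.measurable.aestronglyMeasurable C (hμ.mono hC)

/-- On laws carried by `K`, `f` may be replaced by a bounded continuous truncation. -/
theorem continuousOn_integral_of_isCompact {K : Set X} (hK : IsCompact K) {f : X → ℝ}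
    (hf : Continuous f) :
    ContinuousOn (fun μ : ProbabilityMeasure X => ∫ x, f x ∂(μ : Measure X))
      {μ | ∀ᵐ x ∂(μ : Measure X), x ∈ K} := by
  obtain ⟨C, hC⟩ := hK.exists_bound_of_continuousOn hf.continuousOn
  let g : BoundedContinuousFunction X ℝ :=
    BoundedContinuousFunction.ofNormedAddCommGroup (fun x => max (-|C|) (min |C| (f x)))
      (by fun_prop) |C| (fun x => by
        rw [Real.norm_eq_abs, abs_le]
        exact ⟨le_max_left _ _, max_le (neg_le_self (abs_nonneg C)) (min_le_left _ _)⟩)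
  refine (ProbabilityMeasure.continuous_integral_boundedContinuousFunction g).continuousOn.congr
    fun μ hμ => integral_congr_ae ?_
  filter_upwards [hμ] with x hx
  have h1 := hC x hx
  rw [Real.norm_eq_abs] at h1
  have h2 := abs_le.1 (h1.trans (le_abs_self C))
  change f x = max (-|C|) (min |C| (f x))
  rw [min_eq_right h2.2, max_eq_right h2.1]

theorem isCompact_setOf_ae_mem [T2Space X] {K : Set X} (hK : IsCompact K) [NormalSpace X] :
    IsCompact {μ : ProbabilityMeasure X | ∀ᵐ x ∂(μ : Measure X), x ∈ K} := by
  -- Prokhorov's theorem with zero mass allowed off the constant compact set `K`.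
  have h := isCompact_setOfPred_probabilityMeasure_mass_eq_compl_isCompact_le (E := X)
    (u := fun _ => 0) (K := fun _ => K) tendsto_const_nhds (fun _ => hK) (Or.inl inferInstance)
  convert h using 1
  ext μ
  simp only [mem_ofPred_eq, nonpos_iff_eq_zero, forall_const]
  rw [ProbabilityMeasure.null_iff_toMeasure_null]
  exact ae_iff

/-- A law on a product carried by the graph of a continuous function is the image of its first
marginal. -/
theorem eq_map_of_ae_graph {A B : Type*} [MeasurableSpace A] [MeasurableSpace B]
    {μ : Measure (A × B)} {g : A → B} (hg : Measurable g) (h : ∀ᵐ z ∂μ, z.2 = g z.1) :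
    μ = (μ.map Prod.fst).map fun x => (x, g x) := by
  have hm : Measurable fun x : A => (x, g x) := measurable_id.prodMk hg
  rw [Measure.map_map hm measurable_fst]
  conv_lhs => rw [← Measure.map_id (μ := μ)]
  refine Measure.map_congr ?_
  filter_upwards [h] with z hz
  exact Prod.ext rfl hz

end Measures

/-! ### The torus and laws with bounded controls -/

theorem Torus.proj_zero (d : ℕ) (a : ℝ) : Torus.proj d a 0 = 0 := by
  ext i
  simp [Torus.proj]

theorem Torus.isOpenMap_proj (d : ℕ) (a : ℝ) : IsOpenMap (Torus.proj d a) := by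
  have h : IsOpenMap (Pi.map fun (_ : Fin d) (y : ℝ) => (y : AddCircle a)) :=
    IsOpenMap.piMap (fun _ => QuotientAddGroup.isOpenMap_coe)
      (Eventually.of_forall fun _ => QuotientAddGroup.mk_surjective)
  exact h.comp (EuclideanSpace.equiv (Fin d) ℝ).toHomeomorph.isOpenMap

variable {d : ℕ} {a T : ℝ} {L : Lagrangian d a T} {r C₀ R : ℝ}

/-- For arbitrary μ the continuity clauses of (A1) are not available; differentiability in flat
coordinates is, and it descends to the torus because the projection is open. -/
theorem RegularLagrangian.continuous_slice (hA1 : RegularLagrangian L) (t : Icc (0 : ℝ) T)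
    (μ : JointLaw d a) : Continuous fun z : Torus d a × Euc d => L t z.1 z.2 μ := by
  rw [continuous_iff_continuousAt]
  rintro ⟨x, α⟩
  let φ : Euc d × Euc d → Torus d a × Euc d := fun h => (x + Torus.proj d a h.1, α + h.2)
  have hφ : IsOpenMap φ :=
    ((isOpenMap_add_left x).comp (Torus.isOpenMap_proj d a)).prodMap (isOpenMap_add_left α)
  have h0 : φ 0 = (x, α) := by simp [φ, Torus.proj_zero]
  have h1 := (hA1.differentiable t x α μ).continuousAt
  have h2 : Tendsto (fun z : Torus d a × Euc d => L t z.1 z.2 μ) (map φ (𝓝 0))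
      (𝓝 (L t x α μ)) := by
    rw [tendsto_map'_iff]
    have h3 := h1.tendsto
    simp only [Prod.fst_zero, Prod.snd_zero, Torus.proj_zero, add_zero] at h3
    exact h3
  exact h2.mono_left (h0 ▸ hφ.nhds_le 0)

/-- States and controls with control of norm at most `R`. -/
def boundedControls (d : ℕ) (a R : ℝ) : Set (Torus d a × Euc d) := {z | ‖z.2‖ ≤ R}

theorem isCompact_boundedControls [Fact (0 < a)] (R : ℝ) : IsCompact (boundedControls d a R) := by
  have h := (isCompact_univ (X := Torus d a)).prod (isCompact_closedBall (0 : Euc d) R)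
  convert h using 1
  ext z
  simp [boundedControls]

theorem isClosed_boundedControls (R : ℝ) : IsClosed (boundedControls d a R) :=
  isClosed_le (by fun_prop) continuous_const

theorem mem_lawsBoundedBy {μ : JointLaw d a}
    (h : ∀ᵐ z ∂(μ : Measure (Torus d a × Euc d)), z ∈ boundedControls d a R) :
    μ ∈ LawsBoundedBy d a R := by
  change LamInf μ ≤ ENNReal.ofReal R
  refine iSup₂_le fun z hz => ?_
  have hz' : z ∈ boundedControls d a R :=
    Measure.support_subset_of_isClosed (isClosed_boundedControls R) h hz
  rw [← ofReal_norm]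
  exact ENNReal.ofReal_le_ofReal hz'

theorem continuous_norm_snd_rpow (hr : 0 < r) :
    Continuous fun z : Torus d a × Euc d => ‖z.2‖ ^ r :=
  (continuous_snd.norm).rpow_const fun _ => Or.inr hr.le

theorem Lam_ne_top_and_toReal_rpow [Fact (0 < a)] (hr : 0 < r) {μ : JointLaw d a}
    (h : ∀ᵐ z ∂(μ : Measure (Torus d a × Euc d)), z ∈ boundedControls d a R) :
    Lam r μ ≠ ∞ ∧ (Lam r μ).toReal ^ r = ∫ z, ‖z.2‖ ^ r ∂(μ : Measure (Torus d a × Euc d)) := by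
  have hint := integrable_of_ae_mem_isCompact (isCompact_boundedControls R)
    (continuous_norm_snd_rpow hr) h
  have h0 : 0 ≤ ∫ z, ‖z.2‖ ^ r ∂(μ : Measure (Torus d a × Euc d)) :=
    integral_nonneg fun z => by positivity
  have e : ∫⁻ z, ‖z.2‖ₑ ^ r ∂(μ : Measure (Torus d a × Euc d))
      = ENNReal.ofReal (∫ z, ‖z.2‖ ^ r ∂(μ : Measure (Torus d a × Euc d))) := by
    rw [ofReal_integral_eq_lintegral_ofReal hint (Eventually.of_forall fun z => by positivity)]
    refine lintegral_congr fun z => ?_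
    rw [← ENNReal.ofReal_rpow_of_nonneg (norm_nonneg _) hr.le, ofReal_norm]
  unfold Lam
  rw [e, ENNReal.ofReal_rpow_of_nonneg h0 (by positivity)]
  refine ⟨ENNReal.ofReal_ne_top, ?_⟩
  rw [ENNReal.toReal_ofReal (by positivity), ← Real.rpow_mul h0, one_div_mul_cancel hr.ne',
    Real.rpow_one]

/-! ### Optimal controls, the variational inequality and uniqueness -/

/-- The running cost `L(t, x, α, μ) + p(x) · α`. -/
noncomputable def cost (L : Lagrangian d a T) (t : Icc (0 : ℝ) T) (p : Torus d a → Euc d) (μ : JointLaw d a)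
    (z : Torus d a × Euc d) : ℝ :=
  L t z.1 z.2 μ + ⟪p z.1, z.2⟫

/-- The optimal feedback control `-H_p(t, x, p(x), μ)`. -/
noncomputable def optControl (L : Lagrangian d a T) (t : Icc (0 : ℝ) T) (p : Torus d a → Euc d)
    (μ : JointLaw d a) (x : Torus d a) : Euc d :=
  -gradHam L t x (p x) μ

variable {t : Icc (0 : ℝ) T} {p : Torus d a → Euc d} {μ ν : JointLaw d a}

theorem continuous_cost (hA1 : RegularLagrangian L) (hp : Continuous p) :
    Continuous (cost L t p μ) :=
  (hA1.continuous_slice t μ).add ((hp.comp continuous_fst).inner continuous_snd)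

theorem RegularLagrangian.continuous_control (hA1 : RegularLagrangian L) (x : Torus d a) :
    Continuous fun α : Euc d => L t x α μ :=
  (hA1.continuous_slice t μ).comp (continuous_const.prodMk continuous_id)

theorem UniqueMaximizer.hasUniqueMaximizers (hA2 : UniqueMaximizer L) (x : Torus d a) :
    HasUniqueMaximizers fun α : Euc d => L t x α μ :=
  fun p => hA2 t x p μ

theorem differentiable_ham (hA1 : RegularLagrangian L) (hA2 : UniqueMaximizer L)
    (x : Torus d a) : Differentiable ℝ fun p' : Euc d => Ham L t x p' μ := by
  intro p'
  obtain ⟨α, hα, -⟩ := hA2 t x p' μ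
  exact ((hA2.hasUniqueMaximizers x).hasGradientAt (hA1.continuous_control x)
    hα).hasFDerivAt.differentiableAt

theorem optControl_spec (hA1 : RegularLagrangian L) (hA2 : UniqueMaximizer L) (x : Torus d a) :
    (∀ β, cost L t p μ (x, optControl L t p μ x) ≤ cost L t p μ (x, β)) ∧
      ∀ α, (∀ β, cost L t p μ (x, α) ≤ cost L t p μ (x, β)) → α = optControl L t p μ x := by
  obtain ⟨α, hα, hαu⟩ := hA2 t x (p x) μ
  have hg : gradHam L t x (p x) μ = -α :=
    ((hA2.hasUniqueMaximizers x).hasGradientAt (hA1.continuous_control x) hα).gradient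
  simp only [optControl, hg, neg_neg, cost]
  refine ⟨fun β => by linarith [hα β], fun β hβ => hαu β fun γ => by linarith [hβ γ]⟩

theorem eq_optControl_of_cost_le (hA1 : RegularLagrangian L) (hA2 : UniqueMaximizer L)
    {x : Torus d a} {α : Euc d}
    (h : cost L t p μ (x, α) ≤ cost L t p μ (x, optControl L t p μ x)) :
    α = optControl L t p μ x :=
  (optControl_spec hA1 hA2 x).2 α fun β => h.trans ((optControl_spec hA1 hA2 x).1 β)

theorem continuous_optControl (hA1 : RegularLagrangian L) (hA2 : UniqueMaximizer L)
    (hp : Continuous p) : Continuous (optControl L t p μ) := by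
  refine continuous_argmin_of_convexOn (F := fun x α => cost L t p μ (x, α))
    (continuous_cost hA1 hp) (fun x => ?_) (fun x => (optControl_spec hA1 hA2 x).1)
    (fun x β h => eq_optControl_of_cost_le hA1 hA2 h)
  exact ((hA2.hasUniqueMaximizers x).convexOn (hA1.continuous_control x)).add
    ((innerSL ℝ (p x)).toLinearMap.convexOn convex_univ)

variable {m : ProbabilityMeasure (Torus d a)}

/-- Separates the marginal constraint, which is linear and weakly closed, from optimality, which is
checked almost everywhere. -/
theorem isFixedPointLaw_iff [Fact (0 < a)] (hA1 : RegularLagrangian L) (hA2 : UniqueMaximizer L)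
    (hp : Continuous p) :
    IsFixedPointLaw L t p m μ ↔
      (μ : Measure (Torus d a × Euc d)).map Prod.fst = (m : Measure (Torus d a)) ∧
        ∀ᵐ z ∂(μ : Measure (Torus d a × Euc d)), z.2 = optControl L t p μ z.1 := by
  have hc : Continuous (optControl L t p μ) := continuous_optControl hA1 hA2 hp
  have hc' : Continuous fun x => (x, optControl L t p μ x) := continuous_id.prodMk hc
  constructor
  · rintro ⟨-, h⟩
    change _ = (m : Measure (Torus d a)).map fun x => (x, optControl L t p μ x) at h
    constructor
    · rw [h, Measure.map_map measurable_fst hc'.measurable]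
      exact Measure.map_id
    · have hs : MeasurableSet {z : Torus d a × Euc d | z.2 = optControl L t p μ z.1} :=
        measurableSet_eq_fun measurable_snd (hc.measurable.comp measurable_fst)
      rw [h, ae_map_iff hc'.measurable.aemeasurable hs]
      exact Eventually.of_forall fun x => rfl
  · rintro ⟨h1, h2⟩
    refine ⟨hc'.measurable.aemeasurable, ?_⟩
    have := eq_map_of_ae_graph hc.measurable h2
    rwa [h1] at this

/-- The optimal control is continuous on a compact torus. This bound depends on μ, but it supplies
the integrability that (A3) needs before any uniform estimate. -/
theorem IsFixedPointLaw.exists_bound [Fact (0 < a)] (hA1 : RegularLagrangian L)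
    (hA2 : UniqueMaximizer L) (hp : Continuous p) (h : IsFixedPointLaw L t p m μ) :
    ∃ R : ℝ, ∀ᵐ z ∂(μ : Measure (Torus d a × Euc d)), z ∈ boundedControls d a R := by
  obtain ⟨C, hC⟩ := (isCompact_univ (X := Torus d a)).exists_bound_of_continuousOn
    (continuous_optControl (t := t) (μ := μ) hA1 hA2 hp).continuousOn
  refine ⟨C, ?_⟩
  filter_upwards [((isFixedPointLaw_iff hA1 hA2 hp).1 h).2] with z hz
  change ‖z.2‖ ≤ C
  rw [hz]
  exact hC _ (mem_univ _)

theorem integrable_cost [Fact (0 < a)] (hA1 : RegularLagrangian L) (hp : Continuous p)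
    (h : ∀ᵐ z ∂(ν : Measure (Torus d a × Euc d)), z ∈ boundedControls d a R) :
    Integrable (cost L t p μ) (ν : Measure (Torus d a × Euc d)) :=
  integrable_of_ae_mem_isCompact (isCompact_boundedControls R) (continuous_cost hA1 hp) h

/-- The term p·α does not depend on the law, so it cancels in the difference of costs and (A3)
applies. -/
theorem integral_cost_monotone [Fact (0 < a)] (hA1 : RegularLagrangian L)
    (hA3 : MonotoneLagrangian L) (hp : Continuous p)
    (hμ : ∃ R, ∀ᵐ z ∂(μ : Measure (Torus d a × Euc d)), z ∈ boundedControls d a R)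
    (hν : ∃ R, ∀ᵐ z ∂(ν : Measure (Torus d a × Euc d)), z ∈ boundedControls d a R) :
    0 ≤ (∫ z, cost L t p μ z ∂(μ : Measure (Torus d a × Euc d)))
      - (∫ z, cost L t p μ z ∂(ν : Measure (Torus d a × Euc d)))
      - (∫ z, cost L t p ν z ∂(μ : Measure (Torus d a × Euc d)))
      + ∫ z, cost L t p ν z ∂(ν : Measure (Torus d a × Euc d)) := by
  obtain ⟨R₁, hμ⟩ := hμ
  obtain ⟨R₂, hν⟩ := hν
  have e : (fun z : Torus d a × Euc d => L t z.1 z.2 μ - L t z.1 z.2 ν)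
      = fun z => cost L t p μ z - cost L t p ν z := by
    ext z
    simp [cost]
  have i1 := integrable_cost (t := t) (μ := μ) hA1 hp hμ
  have i2 := integrable_cost (t := t) (μ := ν) hA1 hp hμ
  have i3 := integrable_cost (t := t) (μ := μ) hA1 hp hν
  have i4 := integrable_cost (t := t) (μ := ν) hA1 hp hν
  have h := hA3 t μ ν (by rw [e]; exact i1.sub i2) (by rw [e]; exact i3.sub i4)
  simp only [e] at h
  rw [integral_sub i1 i2, integral_sub i3 i4] at h
  linarith

theorem integral_comp_fst {f : Torus d a → ℝ} [Fact (0 < a)] (hf : Continuous f)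
    (hμ : (μ : Measure (Torus d a × Euc d)).map Prod.fst = (m : Measure (Torus d a))) :
    ∫ z, f z.1 ∂(μ : Measure (Torus d a × Euc d)) = ∫ x, f x ∂(m : Measure (Torus d a)) := by
  rw [← hμ, integral_map measurable_fst.aemeasurable hf.aestronglyMeasurable]

/-- The optimal cost integrated against the state marginal bounds from below the mean cost. -/
theorem integral_optimal_cost_le [Fact (0 < a)] (hA1 : RegularLagrangian L)
    (hA2 : UniqueMaximizer L) (hp : Continuous p)
    (hνb : ∀ᵐ z ∂(ν : Measure (Torus d a × Euc d)), z ∈ boundedControls d a R)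
    (hν : (ν : Measure (Torus d a × Euc d)).map Prod.fst = (m : Measure (Torus d a))) :
    ∫ x, cost L t p μ (x, optControl L t p μ x) ∂(m : Measure (Torus d a))
        ≤ ∫ z, cost L t p μ z ∂(ν : Measure (Torus d a × Euc d)) ∧
      ((∫ z, cost L t p μ z ∂(ν : Measure (Torus d a × Euc d))
          ≤ ∫ x, cost L t p μ (x, optControl L t p μ x) ∂(m : Measure (Torus d a))) →
        ∀ᵐ z ∂(ν : Measure (Torus d a × Euc d)), z.2 = optControl L t p μ z.1) := by
  have hV : Continuous fun x => cost L t p μ (x, optControl L t p μ x) :=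
    (continuous_cost hA1 hp).comp (continuous_id.prodMk (continuous_optControl hA1 hA2 hp))
  have i1 := integrable_cost (t := t) (μ := μ) hA1 hp hνb
  have i2 : Integrable (fun z : Torus d a × Euc d =>
      cost L t p μ (z.1, optControl L t p μ z.1)) (ν : Measure (Torus d a × Euc d)) :=
    integrable_of_ae_mem_isCompact (isCompact_boundedControls R) (hV.comp continuous_fst) hνb
  rw [← integral_comp_fst hV hν]
  have hle : ∀ z : Torus d a × Euc d,
      cost L t p μ (z.1, optControl L t p μ z.1) ≤ cost L t p μ z :=
    fun z => (optControl_spec hA1 hA2 z.1).1 z.2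
  refine ⟨integral_mono i2 i1 hle, fun h => ?_⟩
  have h0 : ∫ z, (cost L t p μ z - cost L t p μ (z.1, optControl L t p μ z.1))
      ∂(ν : Measure (Torus d a × Euc d)) = 0 := by
    refine le_antisymm ?_ (integral_nonneg fun z => sub_nonneg.2 (hle z))
    rw [integral_sub i1 i2]
    exact sub_nonpos.2 h
  have h1 := (integral_eq_zero_iff_of_nonneg (fun z => sub_nonneg.2 (hle z)) (i1.sub i2)).1 h0
  filter_upwards [h1] with z hz
  exact eq_optControl_of_cost_le hA1 hA2 (sub_eq_zero.1 hz).le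

theorem IsFixedPointLaw.integral_cost_eq [Fact (0 < a)] (hA1 : RegularLagrangian L)
    (hA2 : UniqueMaximizer L) (hp : Continuous p) (h : IsFixedPointLaw L t p m μ) :
    ∫ z, cost L t p μ z ∂(μ : Measure (Torus d a × Euc d))
      = ∫ x, cost L t p μ (x, optControl L t p μ x) ∂(m : Measure (Torus d a)) := by
  have hV : Continuous fun x => cost L t p μ (x, optControl L t p μ x) :=
    (continuous_cost hA1 hp).comp (continuous_id.prodMk (continuous_optControl hA1 hA2 hp))
  obtain ⟨h1, h2⟩ := (isFixedPointLaw_iff hA1 hA2 hp).1 h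
  rw [← integral_comp_fst hV h1]
  refine integral_congr_ae ?_
  filter_upwards [h2] with z hz
  rw [← hz]

theorem IsFixedPointLaw.unique [Fact (0 < a)] (hA1 : RegularLagrangian L)
    (hA2 : UniqueMaximizer L) (hA3 : MonotoneLagrangian L) (hp : Continuous p)
    (hμ : IsFixedPointLaw L t p m μ) (hν : IsFixedPointLaw L t p m ν) : ν = μ := by
  obtain ⟨R₁, bμ⟩ := hμ.exists_bound hA1 hA2 hp
  obtain ⟨R₂, bν⟩ := hν.exists_bound hA1 hA2 hp
  have mμ := ((isFixedPointLaw_iff hA1 hA2 hp).1 hμ).1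
  have mν := ((isFixedPointLaw_iff hA1 hA2 hp).1 hν).1
  have h := integral_cost_monotone (t := t) hA1 hA3 hp ⟨R₁, bμ⟩ ⟨R₂, bν⟩
  have e1 := hμ.integral_cost_eq hA1 hA2 hp
  have e2 := hν.integral_cost_eq hA1 hA2 hp
  have l1 := integral_optimal_cost_le (t := t) (μ := μ) hA1 hA2 hp bν mν
  have l2 := (integral_optimal_cost_le (t := t) (μ := ν) hA1 hA2 hp bμ mμ).1
  -- Monotonicity and optimality of both laws make ν optimal for the cost of μ, so ν is carried by
  -- the graph of the optimal control for μ.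
  have key := eq_map_of_ae_graph (continuous_optControl hA1 hA2 hp).measurable
    (l1.2 (by linarith))
  rw [mν] at key
  exact Subtype.ext (key.trans hμ.2.symm)

/-- A fixed point satisfies the Minty inequality. -/
theorem IsFixedPointLaw.minty [Fact (0 < a)] (hA1 : RegularLagrangian L)
    (hA2 : UniqueMaximizer L) (hA3 : MonotoneLagrangian L) (hp : Continuous p)
    (hμ : IsFixedPointLaw L t p m μ)
    (hνb : ∀ᵐ z ∂(ν : Measure (Torus d a × Euc d)), z ∈ boundedControls d a R)
    (hν : (ν : Measure (Torus d a × Euc d)).map Prod.fst = (m : Measure (Torus d a))) :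
    ∫ z, cost L t p ν z ∂(μ : Measure (Torus d a × Euc d))
      ≤ ∫ z, cost L t p ν z ∂(ν : Measure (Torus d a × Euc d)) := by
  have h := integral_cost_monotone (t := t) hA1 hA3 hp (hμ.exists_bound hA1 hA2 hp) ⟨R, hνb⟩
  have e1 := hμ.integral_cost_eq hA1 hA2 hp
  have l1 := (integral_optimal_cost_le (t := t) (μ := μ) hA1 hA2 hp hνb hν).1
  linarith

/-! ### A priori bound on optimal controls -/

theorem exists_mul_le_mul_rpow_add {r P c : ℝ} (hr : 1 < r) (hP : 0 ≤ P) (hc : 0 < c) :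
    ∃ C : ℝ, 0 ≤ C ∧ ∀ s : ℝ, 0 ≤ s → P * s ≤ c * s ^ r + C := by
  -- Beyond this threshold `c * s ^ r` dominates `P * s`.
  set s₀ := (P / c) ^ (1 / (r - 1)) with hs₀
  have h0 : 0 ≤ s₀ := by positivity
  have hr1 : 0 < r - 1 := sub_pos.2 hr
  refine ⟨P * s₀, by positivity, fun s hs => ?_⟩
  rcases le_or_gt s s₀ with h | h
  · have h1 := mul_le_mul_of_nonneg_left h hP
    have h2 : 0 ≤ c * s ^ r := by positivity
    linarith
  · have hspos : 0 < s := h0.trans_lt h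
    have h1 : P / c ≤ s ^ (r - 1) := by
      have := Real.rpow_le_rpow h0 h.le hr1.le
      rwa [hs₀, ← Real.rpow_mul (by positivity), one_div_mul_cancel hr1.ne', Real.rpow_one] at this
    have h2 : s ^ r = s ^ (r - 1) * s := by
      rw [← Real.rpow_add_one hspos.ne', sub_add_cancel]
    rw [div_le_iff₀ hc] at h1
    have h3 := mul_le_mul_of_nonneg_right h1 hs
    have h4 : 0 ≤ P * s₀ := by positivity
    rw [h2]
    linarith

/-- Laws that satisfy the Minty inequality against the law with zero control have optimal
controls that are bounded uniformly. -/
theorem exists_optControl_bound [Fact (0 < a)] (hA1 : RegularLagrangian L)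
    (hA2 : UniqueMaximizer L) (hr : 1 < r) (hC₀ : 0 < C₀)
    (hA4 : CoerciveLagrangian L r C₀) (hA5 : BoundedLagrangian L r C₀) {P : ℝ} (hP : 0 ≤ P) :
    ∃ R : ℝ, 0 < R ∧ ∀ (t : Icc (0 : ℝ) T) (p : Torus d a → Euc d), Continuous p →
      (∀ x, ‖p x‖ ≤ P) → ∀ ν μ : JointLaw d a,
      (∀ᵐ z ∂(ν : Measure (Torus d a × Euc d)), z.2 = 0) →
      (∃ R', ∀ᵐ z ∂(μ : Measure (Torus d a × Euc d)), z ∈ boundedControls d a R') →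
      ∫ z, cost L t p ν z ∂(μ : Measure (Torus d a × Euc d))
        ≤ ∫ z, cost L t p ν z ∂(ν : Measure (Torus d a × Euc d)) →
      ∀ x, ‖optControl L t p μ x‖ ≤ R := by
  have hr0 : 0 < r := one_pos.trans hr
  -- Half of the coercivity absorbs p·α. `M` will bound Λ_r(μ)^r, by testing the Minty inequality on
  -- ν; `N` will bound |α|^r, by comparing the optimal α with 0 under the cost of μ. Then |α| ≤ 1 +
  -- `N` since r > 1.
  obtain ⟨C, hC, hY⟩ := exists_mul_le_mul_rpow_add (c := C₀⁻¹ / 2) hr hP (by positivity)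
  set M := 2 * C₀ * (2 * C₀ + C) with hM
  set N := 2 * C₀ * (2 * C₀ * (1 + M) + C) with hN
  have hN0 : 0 ≤ N := by positivity
  refine ⟨1 + N, by positivity, ?_⟩
  intro t p hp hpP ν μ hν hμ hmin x
  obtain ⟨R', hμ⟩ := hμ
  have hinner : ∀ (y : Torus d a) (α : Euc d), |⟪p y, α⟫| ≤ C₀⁻¹ / 2 * ‖α‖ ^ r + C := by
    intro y α
    calc |⟪p y, α⟫| ≤ ‖p y‖ * ‖α‖ := abs_real_inner_le_norm _ _
      _ ≤ P * ‖α‖ := mul_le_mul_of_nonneg_right (hpP y) (norm_nonneg _)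
      _ ≤ _ := hY _ (norm_nonneg _)
  have hscale : ∀ u v : ℝ, C₀⁻¹ / 2 * u ≤ v → u ≤ 2 * C₀ * v := by
    intro u v h
    have h1 := mul_le_mul_of_nonneg_left h (by positivity : (0 : ℝ) ≤ 2 * C₀)
    have h2 : 2 * C₀ * (C₀⁻¹ / 2 * u) = u := by field_simp
    linarith
  have hνb : ∀ᵐ z ∂(ν : Measure (Torus d a × Euc d)), z ∈ boundedControls d a 0 := by
    filter_upwards [hν] with z hz
    simp [boundedControls, hz]
  obtain ⟨hνtop, hνLam⟩ := Lam_ne_top_and_toReal_rpow hr0 hνb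
  obtain ⟨hμtop, hμLam⟩ := Lam_ne_top_and_toReal_rpow hr0 hμ
  have hν0 : (Lam r ν).toReal ^ r = 0 := by
    rw [hνLam]
    refine integral_eq_zero_of_ae ?_
    filter_upwards [hν] with z hz
    simp [hz, hr0.ne']
  have hup : ∫ z, cost L t p ν z ∂(ν : Measure (Torus d a × Euc d)) ≤ C₀ := by
    have h1 : ∫ z, cost L t p ν z ∂(ν : Measure (Torus d a × Euc d))
        ≤ ∫ _, C₀ ∂(ν : Measure (Torus d a × Euc d)) := by
      refine integral_mono_ae (integrable_cost hA1 hp hνb) (integrable_const _) ?_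
      filter_upwards [hν] with z hz
      have h2 := (abs_le.1 (hA5 t z.1 z.2 ν hνtop).1).2
      rw [hν0, hz, norm_zero, Real.zero_rpow hr0.ne'] at h2
      simp only [cost, hz, inner_zero_right]
      linarith
    simpa using h1
  have hint := integrable_of_ae_mem_isCompact (isCompact_boundedControls R')
    (continuous_norm_snd_rpow hr0) hμ
  have hlow : C₀⁻¹ / 2 * (∫ z, ‖z.2‖ ^ r ∂(μ : Measure (Torus d a × Euc d))) - (C₀ + C)
      ≤ ∫ z, cost L t p ν z ∂(μ : Measure (Torus d a × Euc d)) := by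
    have h1 : ∫ z, (C₀⁻¹ / 2 * ‖z.2‖ ^ r - (C₀ + C)) ∂(μ : Measure (Torus d a × Euc d))
        ≤ ∫ z, cost L t p ν z ∂(μ : Measure (Torus d a × Euc d)) := by
      refine integral_mono ((hint.const_mul _).sub (integrable_const _))
        (integrable_cost hA1 hp hμ) fun z => ?_
      have h2 := hA4 t z.1 z.2 ν hνtop
      have h3 := (abs_le.1 (hinner z.1 z.2)).1
      rw [hν0] at h2
      simp only [cost]
      linarith
    rw [integral_sub (hint.const_mul _) (integrable_const _), integral_const_mul] at h1
    simpa using h1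
  have hI : (Lam r μ).toReal ^ r ≤ M := by
    rw [hμLam]
    exact hscale _ _ (by linarith)
  set α := optControl L t p μ x with hα
  have hopt := (optControl_spec (t := t) (p := p) (μ := μ) hA1 hA2 x).1 0
  rw [← hα] at hopt
  simp only [cost, inner_zero_right, add_zero] at hopt
  have h1 := hA4 t x α μ hμtop
  have h2 := (abs_le.1 (hA5 t x 0 μ hμtop).1).2
  rw [norm_zero, Real.zero_rpow hr0.ne'] at h2
  have h3 := (abs_le.1 (hinner x α)).1
  have h4 := mul_le_mul_of_nonneg_left hI hC₀.le
  have h5 : ‖α‖ ^ r ≤ N := hscale _ _ (by linarith)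
  rcases le_or_gt ‖α‖ 1 with h | h
  · linarith
  · have h6 : ‖α‖ ^ (1 : ℝ) ≤ ‖α‖ ^ r := Real.rpow_le_rpow_of_exponent_le h.le hr.le
    rw [Real.rpow_one] at h6
    linarith

/-! ### Admissible laws and existence -/

/-- Joint continuity of the cost along laws with uniformly bounded controls. -/
theorem tendsto_cost (hA1 : RegularLagrangian L) {q : Icc (0 : ℝ) T → Torus d a → Euc d}
    (hq : Continuous fun z : Icc (0 : ℝ) T × Torus d a => q z.1 z.2) (hR : 0 < R)
    {ι : Type*} {l : Filter ι} {τ : ι → Icc (0 : ℝ) T} {ρ : ι → JointLaw d a}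
    {ζ : ι → Torus d a × Euc d} {z : Torus d a × Euc d} (hτ : Tendsto τ l (𝓝 t))
    (hρ : Tendsto ρ l (𝓝 μ)) (hζ : Tendsto ζ l (𝓝 z))
    (hρR : ∀ᶠ i in l, ∀ᵐ z ∂(ρ i : Measure (Torus d a × Euc d)), z ∈ boundedControls d a R)
    (hμR : ∀ᵐ z ∂(μ : Measure (Torus d a × Euc d)), z ∈ boundedControls d a R) :
    Tendsto (fun i => cost L (τ i) (q (τ i)) (ρ i) (ζ i)) l (𝓝 (cost L t (q t) μ z)) := by
  have hζ1 := (continuous_fst.tendsto z).comp hζ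
  have hζ2 := (continuous_snd.tendsto z).comp hζ
  have h1 := (hA1.continuous_L R hR (t, z.1, z.2, μ) (mem_lawsBoundedBy hμR)).tendsto
  have h2 : Tendsto (fun i => (τ i, (ζ i).1, (ζ i).2, ρ i)) l
      (𝓝[{w | w.2.2.2 ∈ LawsBoundedBy d a R}] (t, z.1, z.2, μ)) := by
    refine tendsto_nhdsWithin_iff.2 ⟨hτ.prodMk_nhds (hζ1.prodMk_nhds (hζ2.prodMk_nhds hρ)), ?_⟩
    filter_upwards [hρR] with i hi
    exact mem_lawsBoundedBy hi
  exact (h1.comp h2).add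
    (((hq.tendsto (t, z.1)).comp (hτ.prodMk_nhds hζ1)).inner hζ2)

/-- Laws with state marginal `m` and controls of norm at most `R`. -/
def admissibleLaws (m : ProbabilityMeasure (Torus d a)) (R : ℝ) : Set (JointLaw d a) :=
  {μ | (∀ᵐ z ∂(μ : Measure (Torus d a × Euc d)), z ∈ boundedControls d a R) ∧
    (μ : Measure (Torus d a × Euc d)).map Prod.fst = (m : Measure (Torus d a))}

theorem isCompact_admissibleLaws [Fact (0 < a)] (m : ProbabilityMeasure (Torus d a)) (R : ℝ) :
    IsCompact (admissibleLaws m R) := by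
  have h1 := isCompact_setOf_ae_mem (isCompact_boundedControls (d := d) (a := a) R)
  have h2 : IsClosed {μ : JointLaw d a |
      μ.map (continuous_fst (X := Torus d a) (Y := Euc d)).measurable.aemeasurable = m} :=
    isClosed_eq (ProbabilityMeasure.continuous_map continuous_fst) continuous_const
  convert h1.inter_right h2 using 1
  ext μ
  refine and_congr Iff.rfl ?_
  rw [mem_ofPred_eq, ← ProbabilityMeasure.toMeasure_injective.eq_iff,
    ProbabilityMeasure.toMeasure_map]

theorem exists_mem_admissibleLaws_ae_graph [Fact (0 < a)] (m : ProbabilityMeasure (Torus d a))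
    {g : Torus d a → Euc d} (hg : Continuous g) (hgR : ∀ x, ‖g x‖ ≤ R) :
    ∃ ν ∈ admissibleLaws m R, (ν : Measure (Torus d a × Euc d)) =
      (m : Measure (Torus d a)).map fun x => (x, g x) := by
  have hc : Measurable fun x => (x, g x) := (continuous_id.prodMk hg).measurable
  refine ⟨m.map hc.aemeasurable, ⟨?_, ?_⟩, ProbabilityMeasure.toMeasure_map _ _⟩
  · have hs : MeasurableSet {z | z ∈ boundedControls d a R} :=
      (isClosed_boundedControls R).measurableSet
    rw [ProbabilityMeasure.toMeasure_map, ae_map_iff hc.aemeasurable hs]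
    exact Eventually.of_forall hgR
  · rw [ProbabilityMeasure.toMeasure_map, Measure.map_map measurable_fst hc]
    exact Measure.map_id

theorem mixture_mem_admissibleLaws {ι : Type*} [Fintype ι] {w : ι → ℝ}
    (hw : w ∈ stdSimplex ℝ ι) {ν : ι → JointLaw d a} (hν : ∀ i, ν i ∈ admissibleLaws m R)
    (hμ : (μ : Measure (Torus d a × Euc d)) =
      ∑ i, ENNReal.ofReal (w i) • (ν i : Measure (Torus d a × Euc d))) :
    μ ∈ admissibleLaws m R := by
  refine ⟨ae_mixture hμ fun i => (hν i).1, ?_⟩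
  ext s hs
  have h : ∀ i, (ν i : Measure (Torus d a × Euc d)) (Prod.fst ⁻¹' s)
      = (m : Measure (Torus d a)) s := fun i => by
    rw [← (hν i).2, Measure.map_apply measurable_fst hs]
  rw [Measure.map_apply measurable_fst hs, hμ]
  simp only [Measure.finsetSum_apply, Measure.smul_apply, smul_eq_mul, h, ← Finset.sum_mul]
  rw [← ENNReal.ofReal_sum_of_nonneg fun i _ => hw.1 i, hw.2, ENNReal.ofReal_one, one_mul]

/-- A solution of the Minty inequality minimizes its own mean cost. -/
theorem integral_cost_le_of_minty [Fact (0 < a)] (hA1 : RegularLagrangian L) (hr : 0 < r)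
    (hC₀ : 0 < C₀) (hA5 : BoundedLagrangian L r C₀) (hp : Continuous p) (hR : 0 < R)
    (hμ : μ ∈ admissibleLaws m R)
    (hmin : ∀ ν ∈ admissibleLaws m R, ∫ z, cost L t p ν z ∂(μ : Measure (Torus d a × Euc d))
      ≤ ∫ z, cost L t p ν z ∂(ν : Measure (Torus d a × Euc d)))
    (hν : ν ∈ admissibleLaws m R) :
    ∫ z, cost L t p μ z ∂(μ : Measure (Torus d a × Euc d))
      ≤ ∫ z, cost L t p μ z ∂(ν : Measure (Torus d a × Euc d)) := by
  set s : ℕ → ℝ := fun n => 1 / ((n : ℝ) + 1) with hs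
  have hs0 : ∀ n, 0 < s n := fun n => Nat.one_div_pos_of_nat
  have hs1 : ∀ n, s n ≤ 1 := fun n => by
    rw [hs]
    exact (div_le_one (by positivity)).2 (by simp)
  have hslim : Tendsto s atTop (𝓝 0) := tendsto_one_div_add_atTop_nhds_zero_nat
  -- Minty's trick: test with (1 - s)μ + sν, cancel the common part, divide by s and let s tend to
  -- 0.
  have hw : ∀ n, ![1 - s n, s n] ∈ stdSimplex ℝ (Fin 2) := by
    refine fun n => ⟨fun i => ?_, by simp⟩
    fin_cases i
    · exact sub_nonneg.2 (hs1 n)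
    · exact (hs0 n).le
  choose ρ hρ using fun n => exists_mixture (hw n) ![μ, ν]
  have hmem : ∀ i, ![μ, ν] i ∈ admissibleLaws m R := by
    intro i
    fin_cases i
    · exact hμ
    · exact hν
  have hρm : ∀ n, ρ n ∈ admissibleLaws m R := fun n =>
    mixture_mem_admissibleLaws (hw n) hmem (hρ n)
  have hρint : ∀ n (f : Torus d a × Euc d → ℝ),
      Integrable f (μ : Measure (Torus d a × Euc d)) →
      Integrable f (ν : Measure (Torus d a × Euc d)) →
      ∫ z, f z ∂(ρ n : Measure (Torus d a × Euc d))
        = (1 - s n) * (∫ z, f z ∂(μ : Measure (Torus d a × Euc d)))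
          + s n * ∫ z, f z ∂(ν : Measure (Torus d a × Euc d)) := by
    intro n f hf1 hf2
    rw [integral_mixture (hw n).1 (hρ n) (f := f) (by
      intro i
      fin_cases i
      · exact hf1
      · exact hf2), Fin.sum_univ_two]
    rfl
  have hρlim : Tendsto ρ atTop (𝓝 μ) := by
    rw [ProbabilityMeasure.tendsto_iff_forall_integral_tendsto]
    intro f
    have h : Tendsto (fun n => (1 - s n) * (∫ z, f z ∂(μ : Measure (Torus d a × Euc d)))
          + s n * ∫ z, f z ∂(ν : Measure (Torus d a × Euc d))) atTop
        (𝓝 ((1 - 0) * (∫ z, f z ∂(μ : Measure (Torus d a × Euc d)))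
          + 0 * ∫ z, f z ∂(ν : Measure (Torus d a × Euc d)))) :=
      ((tendsto_const_nhds.sub hslim).mul_const _).add (hslim.mul_const _)
    rw [sub_zero, one_mul, zero_mul, add_zero] at h
    exact h.congr fun n => (hρint n f (f.integrable _) (f.integrable _)).symm
  have hstep : ∀ n, ∫ z, cost L t p (ρ n) z ∂(μ : Measure (Torus d a × Euc d))
      ≤ ∫ z, cost L t p (ρ n) z ∂(ν : Measure (Torus d a × Euc d)) := by
    intro n
    have h1 := hmin (ρ n) (hρm n)
    rw [hρint n _ (integrable_cost hA1 hp hμ.1) (integrable_cost hA1 hp hν.1)] at h1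
    refine le_of_mul_le_mul_left ?_ (hs0 n)
    linarith
  obtain ⟨P, hP⟩ := (isCompact_univ (X := Torus d a)).exists_bound_of_continuousOn hp.continuousOn
  have hRr : ∀ η ∈ admissibleLaws m R, Lam r η ≠ ∞ ∧ (Lam r η).toReal ^ r ≤ R ^ r := by
    intro η hη
    obtain ⟨h1, h2⟩ := Lam_ne_top_and_toReal_rpow hr hη.1
    refine ⟨h1, ?_⟩
    rw [h2]
    have h3 : ∫ z, ‖z.2‖ ^ r ∂(η : Measure (Torus d a × Euc d))
        ≤ ∫ _, R ^ r ∂(η : Measure (Torus d a × Euc d)) := by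
      refine integral_mono_ae (integrable_of_ae_mem_isCompact (isCompact_boundedControls R)
        (continuous_norm_snd_rpow hr) hη.1) (integrable_const _) ?_
      filter_upwards [hη.1] with z hz
      exact Real.rpow_le_rpow (norm_nonneg _) hz hr.le
    simpa using h3
  have hlim : ∀ η ∈ admissibleLaws m R,
      Tendsto (fun n => ∫ z, cost L t p (ρ n) z ∂(η : Measure (Torus d a × Euc d))) atTop
        (𝓝 (∫ z, cost L t p μ z ∂(η : Measure (Torus d a × Euc d)))) := by
    intro η hη
    -- The integrand varies while the measure η is fixed: (A1) gives pointwise convergence along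
    -- laws bounded by `R`, and (A5) gives the constant majorant.
    refine tendsto_integral_of_dominated_convergence
      (fun _ => C₀ * (1 + R ^ r + R ^ r) + P * R)
      (fun n => (continuous_cost hA1 hp).measurable.aestronglyMeasurable) (integrable_const _)
      (fun n => ?_) (Eventually.of_forall fun z => ?_)
    · filter_upwards [hη.1] with z hz
      obtain ⟨h1, h2⟩ := hRr (ρ n) (hρm n)
      have h3 : ‖z.2‖ ^ r ≤ R ^ r := Real.rpow_le_rpow (norm_nonneg _) hz hr.le
      have h4 : |⟪p z.1, z.2⟫| ≤ P * R := (abs_real_inner_le_norm _ _).trans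
        (mul_le_mul (hP _ (mem_univ _)) hz (norm_nonneg _)
          ((norm_nonneg _).trans (hP z.1 (mem_univ _))))
      have h5 : |L t z.1 z.2 (ρ n)| ≤ C₀ * (1 + R ^ r + R ^ r) :=
        (hA5 t z.1 z.2 (ρ n) h1).1.trans (mul_le_mul_of_nonneg_left (by linarith) hC₀.le)
      exact (abs_add_le _ _).trans (add_le_add h5 h4)
    · exact tendsto_cost hA1 (q := fun _ => p) (hp.comp continuous_snd) hR tendsto_const_nhds
        hρlim tendsto_const_nhds (Eventually.of_forall fun n => (hρm n).1) hμ.1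
  exact le_of_tendsto_of_tendsto' (hlim μ hμ) (hlim ν hν) hstep

/-- The Minty solution has optimal control bounded by the same `R` that defines the constraint. The
graph law of that control is therefore an admissible competitor, and comparison with it forces μ
onto the graph. -/
theorem exists_isFixedPointLaw [Fact (0 < a)] (hA1 : RegularLagrangian L)
    (hA2 : UniqueMaximizer L) (hA3 : MonotoneLagrangian L) (hr : 1 < r) (hC₀ : 0 < C₀)
    (hA4 : CoerciveLagrangian L r C₀) (hA5 : BoundedLagrangian L r C₀) (hp : Continuous p) :
    ∃ μ : JointLaw d a, IsFixedPointLaw L t p m μ := by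
  obtain ⟨P, hP⟩ := (isCompact_univ (X := Torus d a)).exists_bound_of_continuousOn hp.continuousOn
  have hP0 : 0 ≤ P := (norm_nonneg _).trans (hP 0 (mem_univ _))
  obtain ⟨R, hR, hbound⟩ := exists_optControl_bound hA1 hA2 hr hC₀ hA4 hA5 hP0
  obtain ⟨ν₀, hν₀, hν₀e⟩ := exists_mem_admissibleLaws_ae_graph (R := R) m
    (continuous_const (y := (0 : Euc d))) (fun _ => by simpa using hR.le)
  obtain ⟨μ, hμ, hmin⟩ := exists_minty (isCompact_admissibleLaws m R) ⟨ν₀, hν₀⟩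
    (fun ν μ => ∫ z, cost L t p ν z ∂(μ : Measure (Torus d a × Euc d)))
    (fun ν _ => (continuousOn_integral_of_isCompact (isCompact_boundedControls R)
      (continuous_cost hA1 hp)).mono fun μ hμ => hμ.1)
    (fun s w hw => by
      obtain ⟨η, hη⟩ := exists_mixture hw fun i : s => ((i : admissibleLaws m R) : JointLaw d a)
      exact ⟨η, mixture_mem_admissibleLaws hw (fun i => i.1.2) hη, fun ν _ =>
        integral_mixture hw.1 hη fun i => integrable_cost hA1 hp i.1.2.1⟩)
    (fun μ hμ ν hν => integral_cost_monotone hA1 hA3 hp ⟨R, hμ.1⟩ ⟨R, hν.1⟩)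
  have hopt : ∀ x, ‖optControl L t p μ x‖ ≤ R := by
    refine hbound t p hp (fun x => hP x (mem_univ x)) ν₀ μ ?_ ⟨R, hμ.1⟩ (hmin ν₀ hν₀)
    rw [hν₀e, ae_map_iff (by fun_prop) (measurableSet_eq_fun measurable_snd measurable_const)]
    exact Eventually.of_forall fun x => rfl
  have hoc : Continuous (optControl L t p μ) := continuous_optControl hA1 hA2 hp
  obtain ⟨ν, hν, hνe⟩ := exists_mem_admissibleLaws_ae_graph m hoc hopt
  refine ⟨μ, (isFixedPointLaw_iff hA1 hA2 hp).2 ⟨hμ.2, ?_⟩⟩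
  refine (integral_optimal_cost_le hA1 hA2 hp hμ.1 hμ.2).2
    ((integral_cost_le_of_minty hA1 (one_pos.trans hr) hC₀ hA5 hp hR hμ hmin hν).trans_eq ?_)
  have hg : Measurable fun x => (x, optControl L t p μ x) :=
    (continuous_id.prodMk hoc).measurable
  rw [hνe, integral_map hg.aemeasurable (continuous_cost hA1 hp).aestronglyMeasurable]

/-! ### Stability and continuity in time -/

/-- A limit of fixed points is a fixed point. -/
theorem isFixedPointLaw_of_tendsto [Fact (0 < a)] (hA1 : RegularLagrangian L)
    (hA2 : UniqueMaximizer L) {q : Icc (0 : ℝ) T → Torus d a → Euc d}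
    (hq : Continuous fun z : Icc (0 : ℝ) T × Torus d a => q z.1 z.2)
    {n : Icc (0 : ℝ) T → ProbabilityMeasure (Torus d a)} (hn : Continuous n) (hR : 0 < R)
    {ρ : Icc (0 : ℝ) T → JointLaw d a} (hρ : ∀ τ, IsFixedPointLaw L τ (q τ) (n τ) (ρ τ))
    (hρR : ∀ τ, ∀ᵐ z ∂(ρ τ : Measure (Torus d a × Euc d)), z ∈ boundedControls d a R)
    {l : Filter (Icc (0 : ℝ) T)} [l.NeBot] (hl : l ≤ 𝓝 t) (hlim : Tendsto ρ l (𝓝 μ))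
    (hμR : ∀ᵐ z ∂(μ : Measure (Torus d a × Euc d)), z ∈ boundedControls d a R) :
    IsFixedPointLaw L t (q t) (n t) μ := by
  have hqc : ∀ τ, Continuous (q τ) := fun τ => hq.comp (continuous_const.prodMk continuous_id)
  have hfix := fun τ => (isFixedPointLaw_iff hA1 hA2 (hqc τ)).1 (hρ τ)
  refine (isFixedPointLaw_iff hA1 hA2 (hqc t)).2 ⟨?_, ?_⟩
  · have hfst : Measurable (Prod.fst : Torus d a × Euc d → Torus d a) := measurable_fst
    have h1 : Tendsto (fun τ => (ρ τ).map hfst.aemeasurable) l (𝓝 (μ.map hfst.aemeasurable)) :=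
      ((ProbabilityMeasure.continuous_map continuous_fst).tendsto μ).comp hlim
    have h2 : (fun τ => (ρ τ).map hfst.aemeasurable) = n := by
      ext1 τ
      apply ProbabilityMeasure.toMeasure_injective
      rw [ProbabilityMeasure.toMeasure_map]
      exact (hfix τ).1
    rw [h2] at h1
    have h3 := tendsto_nhds_unique h1 ((hn.tendsto t).mono_left hl)
    rw [← h3, ProbabilityMeasure.toMeasure_map]
  -- Optimality is proved at each point of the support. If β beat z strictly, it would still do so
  -- for nearby times and states on an open set `G` around z. By the portmanteau inequality some `ρ
  -- τ` charges `G`, although `ρ τ` is carried by optimal controls.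
  · filter_upwards [Measure.support_mem_ae (μ := (μ : Measure (Torus d a × Euc d)))] with z hz
    refine (optControl_spec hA1 hA2 z.1).2 z.2 fun β => ?_
    by_contra hlt
    rw [not_le] at hlt
    have hτ : Tendsto (fun w : Icc (0 : ℝ) T × Torus d a × Euc d => w.1) (l ×ˢ 𝓝 z) (𝓝 t) :=
      tendsto_fst.mono_right hl
    have hρ' : Tendsto (fun w : Icc (0 : ℝ) T × Torus d a × Euc d => ρ w.1) (l ×ˢ 𝓝 z) (𝓝 μ) :=
      hlim.comp tendsto_fst
    have hz2 : Tendsto (fun w : Icc (0 : ℝ) T × Torus d a × Euc d => w.2) (l ×ˢ 𝓝 z) (𝓝 z) :=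
      tendsto_snd
    have hzβ : Tendsto (fun w : Icc (0 : ℝ) T × Torus d a × Euc d => (w.2.1, β)) (l ×ˢ 𝓝 z)
        (𝓝 (z.1, β)) :=
      ((continuous_fst.tendsto z).comp hz2).prodMk_nhds tendsto_const_nhds
    have hev := (tendsto_cost hA1 hq hR hτ hρ' hzβ (Eventually.of_forall fun w => hρR w.1)
      hμR).eventually_lt (tendsto_cost hA1 hq hR hτ hρ' hz2
        (Eventually.of_forall fun w => hρR w.1) hμR) hlt
    obtain ⟨V, hV, U, hU, hVU⟩ := eventually_prod_iff.1 hev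
    obtain ⟨G, hGU, hG, hzG⟩ := eventually_nhds_iff.1 hU |>.imp fun G h => h
    have hpos : 0 < (μ : Measure (Torus d a × Euc d)) G :=
      (Measure.mem_support_iff_forall z).1 hz G (hG.mem_nhds hzG)
    have hlow := hpos.trans_le (ProbabilityMeasure.le_liminf_measure_open_of_tendsto hlim hG)
    obtain ⟨τ, hτG, hτV⟩ := ((eventually_lt_of_lt_liminf hlow).and hV).exists
    have hnull : (ρ τ : Measure (Torus d a × Euc d)) G = 0 := by
      refine measure_mono_null ?_ (ae_iff.1 (hfix τ).2)
      intro z' hz' hz'e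
      have h1 := (optControl_spec (t := τ) (p := q τ) (μ := ρ τ) hA1 hA2 z'.1).1 β
      rw [← hz'e] at h1
      exact absurd (hVU hτV (hGU z' hz')) (not_lt.2 h1)
    exact hτG.ne' hnull

theorem continuous_of_isFixedPointLaw [Fact (0 < a)] (hA1 : RegularLagrangian L)
    (hA2 : UniqueMaximizer L) (hA3 : MonotoneLagrangian L) (hr : 1 < r) (hC₀ : 0 < C₀)
    (hA4 : CoerciveLagrangian L r C₀) (hA5 : BoundedLagrangian L r C₀)
    {q : Icc (0 : ℝ) T → Torus d a → Euc d}
    (hq : Continuous fun z : Icc (0 : ℝ) T × Torus d a => q z.1 z.2)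
    {n : Icc (0 : ℝ) T → ProbabilityMeasure (Torus d a)} (hn : Continuous n)
    {ρ : Icc (0 : ℝ) T → JointLaw d a} (hρ : ∀ τ, IsFixedPointLaw L τ (q τ) (n τ) (ρ τ)) :
    Continuous ρ := by
  have hqc : ∀ τ, Continuous (q τ) := fun τ => hq.comp (continuous_const.prodMk continuous_id)
  obtain ⟨P, hP⟩ := (isCompact_univ (X := Icc (0 : ℝ) T × Torus d a)).exists_bound_of_continuousOn
    hq.continuousOn
  obtain ⟨R, hR, hbound⟩ := exists_optControl_bound hA1 hA2 hr hC₀ hA4 hA5 (le_max_right P 0)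
  have hρR : ∀ τ, ∀ᵐ z ∂(ρ τ : Measure (Torus d a × Euc d)), z ∈ boundedControls d a R := by
    intro τ
    -- Each fixed point satisfies the Minty inequality against the zero-control law, hence obeys a
    -- bound independent of τ.
    obtain ⟨ν₀, hν₀, hν₀e⟩ := exists_mem_admissibleLaws_ae_graph (R := R) (n τ)
      (continuous_const (y := (0 : Euc d))) (fun _ => by simpa using hR.le)
    have hopt := hbound τ (q τ) (hqc τ)
      (fun x => (hP (τ, x) (mem_univ _)).trans (le_max_left _ _)) ν₀ (ρ τ) (by
        rw [hν₀e, ae_map_iff (by fun_prop) (measurableSet_eq_fun measurable_snd measurable_const)]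
        exact Eventually.of_forall fun x => rfl)
      ((hρ τ).exists_bound hA1 hA2 (hqc τ))
      ((hρ τ).minty hA1 hA2 hA3 (hqc τ) hν₀.1 hν₀.2)
    filter_upwards [((isFixedPointLaw_iff hA1 hA2 (hqc τ)).1 (hρ τ)).2] with z hz
    change ‖z.2‖ ≤ R
    rw [hz]
    exact hopt z.1
  -- Compactness gives a limit along every ultrafilter; that limit is a fixed point at τ, hence
  -- equals `ρ τ`.
  rw [continuous_iff_ultrafilter]
  intro τ g hg
  obtain ⟨μ, hμ, hlim⟩ := (isCompact_setOf_ae_mem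
    (isCompact_boundedControls (d := d) (a := a) R)).ultrafilter_le_nhds (g.map ρ) (by
      rw [Ultrafilter.coe_map, le_principal_iff, mem_map]
      exact univ_mem' hρR)
  have hlim' : Tendsto ρ g (𝓝 μ) := hlim
  have hfix := isFixedPointLaw_of_tendsto hA1 hA2 hq hn hR hρ hρR hg hlim' hμ
  rwa [(hρ τ).unique hA1 hA2 hA3 (hqc τ) hfix] at hlim'

end MFGC

theorem mainTheorem8 (d : ℕ) (a T q C₀ : ℝ) (ha : 0 < a) (hT : 0 < T) (hq : 1 < q)
    (hC₀ : 0 < C₀) (L : MFGC.Lagrangian d a T)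
    (hA1 : MFGC.RegularLagrangian L)
    (hA2 : MFGC.UniqueMaximizer L)
    (hA3 : MFGC.MonotoneLagrangian L)
    (hA4 : MFGC.CoerciveLagrangian L (q / (q - 1)) C₀)
    (hA5 : MFGC.BoundedLagrangian L (q / (q - 1)) C₀)
    (p : Icc (0 : ℝ) T → MFGC.Torus d a → MFGC.Euc d)
    (hp : Continuous (fun z : Icc (0 : ℝ) T × MFGC.Torus d a => p z.1 z.2))
    (m : Icc (0 : ℝ) T → ProbabilityMeasure (MFGC.Torus d a))
    (hm : Continuous m)
    (hm2 : ∃ K : ℝ≥0∞, K ≠ ∞ ∧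
      ∀ t, ∫⁻ x, ∑ i, ‖x i‖ₑ ^ 2 ∂(m t : Measure (MFGC.Torus d a)) ≤ K) :
    (∀ (t : Icc (0 : ℝ) T) (x : MFGC.Torus d a) (μ : MFGC.JointLaw d a),
      Differentiable ℝ (fun p' : MFGC.Euc d => MFGC.Ham L t x p' μ)) ∧
    (∀ t : Icc (0 : ℝ) T, ∃! μ : MFGC.JointLaw d a,
      MFGC.IsFixedPointLaw L t (p t) (m t) μ) ∧
    (∀ μ : Icc (0 : ℝ) T → MFGC.JointLaw d a,
      (∀ t, MFGC.IsFixedPointLaw L t (p t) (m t) (μ t)) → Continuous μ) := by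
  have : Fact (0 < a) := ⟨ha⟩
  have hr : 1 < q / (q - 1) := by
    rw [one_lt_div (sub_pos.2 hq)]
    linarith
  have hpc : ∀ t, Continuous (p t) := fun t => hp.comp (continuous_const.prodMk continuous_id)
  refine ⟨fun t x μ => MFGC.differentiable_ham hA1 hA2 x, fun t => ?_, fun μ hμ =>
    MFGC.continuous_of_isFixedPointLaw hA1 hA2 hA3 hr hC₀ hA4 hA5 hp hm hμ⟩
  obtain ⟨μ, hμ⟩ := MFGC.exists_isFixedPointLaw (t := t) (m := m t) hA1 hA2 hA3 hr hC₀ hA4 hA5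
    (hpc t)
  exact ⟨μ, hμ, fun ν hν => hμ.unique hA1 hA2 hA3 (hpc t) hν⟩
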